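/- Let $R$ be a commutative ring that is either a regular local ring or a regular ring, i.e. a Noetherian ring all of whose localizations at primes are regular local rings (this includes every regular graded ring over a field). For an ideal $J\subseteq R$ let $\overline{J}$ denote its integral closure, that is, the ideal of all $x\in R$ satisfying an equation $x^n+a_1x^{n-1}+\cdots+a_n=0$ with $n\ge 1$ and $a_i\in J^i$. For a rational number $u>0$, written $u=a/b$ in lowest terms with positive integers $a,b$, let $\overline{J^u}=\{x\in R : x^b\in\overline{J^a}\}$ be the $u$-th rational power of $J$. For an ideal $I\subseteq R$ the $n$-th symbolic power and the $u$-th rational symbolic power of $I$ are $$I^{(n)}=\bigcap_{\mathfrak p\in\operatorname{Ass}(R/I)}\left(I^nR_{\mathfrak p}\cap R\right),\qquad \overline{I^{(u)}}=\bigcap_{\mathfrak p\in\operatorname{Ass}(R/I)}\left(\overline{I^u}\,R_{\mathfrak p}\cap R\right),$$ where $\cap R$ denotes the preimage under $R\to R_{\mathfrak p}$. (The intersection is $R$ if $I=R$.) Let $I\subseteq R$ be a radical ideal and let $p,q$ be positive integers, not necessarily coprime. Then $$\overline{I^{(p/q)}}=\{x\in R : x^q\in\overline{I^{(p)}}\}=\{x\in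 R : x^q\in I^{(p)}\}=\overline{\left(I^{(p)}\right)^{1/q}},$$ where the second set is the same whether $\overline{I^{(p)}}$ is read as the rational symbolic power of exponent $p$ or as the integral closure of the ideal $I^{(p)}$, and the last ideal is the rational power of exponent $1/q$ of $I^{(p)}$. -/

import Mathlib

namespace RationalSymbolic

open Polynomial

variable {R : Type*} [CommRing R]

/-- `x` is integral over the ideal `I`: it satisfies an equation
`x ^ n + a₁ x ^ (n - 1) + ⋯ + aₙ = 0` with `n ≥ 1` and `aᵢ ∈ I ^ i`. -/
def IsIntegralOverIdeal (I : Ideal R) (x : R) : Prop :=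
  ∃ (n : ℕ) (a : ℕ → R), 1 ≤ n ∧ (∀ i ∈ Finset.Icc 1 n, a i ∈ I ^ i) ∧
    x ^ n + ∑ i ∈ Finset.Icc 1 n, a i * x ^ (n - i) = 0

/-- Auxiliary Rees-type algebra: the polynomials whose coefficient in degree `n` lies in
`I ^ ⌈n / q⌉`. It is used only to show that the sets defined below are ideals. -/
def ceilRees (I : Ideal R) (q : ℕ) (hq : 0 < q) : Subalgebra R R[X] where
  carrier := {f | ∀ n, f.coeff n ∈ I ^ ((n + q - 1) / q)}
  mul_mem' := by
    intro f g hf hg n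
    rw [coeff_mul]
    refine Ideal.sum_mem _ fun c hc => ?_
    rw [Finset.HasAntidiagonal.mem_antidiagonal] at hc
    have h := Ideal.mul_mem_mul (hf c.1) (hg c.2)
    rw [← pow_add] at h
    refine Ideal.pow_le_pow_right ?_ h
    rw [← hc]
    have h1 := Nat.div_add_mod (c.1 + q - 1) q
    have h2 := Nat.div_add_mod (c.2 + q - 1) q
    have h3 := Nat.mod_lt (c.1 + q - 1) hq
    have h4 := Nat.mod_lt (c.2 + q - 1) hq
    rw [← Nat.lt_succ_iff, Nat.div_lt_iff_lt_mul hq]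
    have h5 : ((c.1 + q - 1) / q + (c.2 + q - 1) / q).succ * q
        = q * ((c.1 + q - 1) / q) + q * ((c.2 + q - 1) / q) + q := by
      rw [Nat.succ_mul]; ring
    omega
  add_mem' := by
    intro f g hf hg n
    rw [coeff_add]
    exact Ideal.add_mem _ (hf n) (hg n)
  algebraMap_mem' := by
    intro r n
    rw [Polynomial.algebraMap_apply, Algebra.algebraMap_self, RingHom.id_apply, coeff_C]
    split_ifs with h
    · subst h
      have : (0 + q - 1) / q = 0 := Nat.div_eq_of_lt (by omega)
      rw [this]; simp
    · exact Ideal.zero_mem _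

theorem mem_ceilRees {I : Ideal R} {q : ℕ} {hq : 0 < q} {f : R[X]} :
    f ∈ ceilRees I q hq ↔ ∀ n, f.coeff n ∈ I ^ ((n + q - 1) / q) := Iff.rfl

/-- Membership `x ^ q ∈ closure (I ^ p)` is integrality of `x T ^ p` over the auxiliary algebra. -/
theorem isIntegralOverIdeal_pow_iff (I : Ideal R) (p q : ℕ) (hq : 0 < q) (x : R) :
    IsIntegralOverIdeal (I ^ p) (x ^ q) ↔ IsIntegral (ceilRees I q hq) (monomial p x) := by
  have key : ∀ i : ℕ, (i * (p * q) + q - 1) / q = p * i := by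
    intro i
    have : i * (p * q) + q - 1 = (q - 1) + q * (p * i) := by
      have : i * (p * q) = q * (p * i) := by ring
      omega
    rw [this, Nat.add_mul_div_left _ _ hq, Nat.div_eq_of_lt (by omega), zero_add]
  constructor
  · rintro ⟨n, a, hn, ha, h⟩
    refine IsIntegral.of_pow hq ?_
    rw [monomial_pow]
    have hmem : ∀ i ∈ Finset.Icc 1 n, monomial (i * (p * q)) (a i) ∈ ceilRees I q hq := by
      intro i hi m
      rw [coeff_monomial]
      split_ifs with hm
      · rw [← hm, key, pow_mul]; exact ha i hi
      · exact Ideal.zero_mem _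
    classical
    let b : ℕ → ceilRees I q hq := fun i =>
      if hi : i ∈ Finset.Icc 1 n then ⟨_, hmem i hi⟩ else 0
    refine ⟨X ^ n + ∑ i ∈ Finset.Icc 1 n, C (b i) * X ^ (n - i), ?_, ?_⟩
    · refine monic_X_pow_add ?_
      refine (degree_sum_le _ _).trans_lt ?_
      rw [Finset.sup_lt_iff (by exact_mod_cast WithBot.bot_lt_coe n)]
      intro i hi
      refine (degree_C_mul_X_pow_le _ _).trans_lt ?_
      rw [Finset.mem_Icc] at hi
      exact_mod_cast (by omega : n - i < n)
    · rw [eval₂_add, eval₂_pow, eval₂_X, eval₂_finsetSum]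
      have hs : ∀ i ∈ Finset.Icc 1 n,
          eval₂ (algebraMap (ceilRees I q hq) R[X]) (monomial (p * q) (x ^ q))
            (C (b i) * X ^ (n - i))
            = monomial (n * (p * q)) (a i * (x ^ q) ^ (n - i)) := by
        intro i hi
        rw [eval₂_mul, eval₂_C, eval₂_pow, eval₂_X]
        have hb : algebraMap (ceilRees I q hq) R[X] (b i) = monomial (i * (p * q)) (a i) := by
          simp only [b, dif_pos hi]; rfl
        rw [hb, monomial_pow, monomial_mul_monomial]
        congr 2
        rw [Finset.mem_Icc] at hi
        obtain ⟨k, rfl⟩ := Nat.exists_eq_add_of_le hi.2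
        rw [Nat.add_sub_cancel_left]; ring
      rw [Finset.sum_congr rfl hs, ← map_sum, monomial_pow, mul_comm (p * q) n, ← map_add, h,
        map_zero]
  · intro hint
    have hint := hint.pow q
    rw [monomial_pow] at hint
    obtain ⟨f, hf, hev⟩ := hint
    let n := f.natDegree + 1
    have hev' : eval₂ (algebraMap (ceilRees I q hq) R[X]) (monomial (p * q) (x ^ q)) (f * X) = 0 := by
      rw [eval₂_mul, hev, zero_mul]
    rcases subsingleton_or_nontrivial R with hR | hR
    · exact ⟨1, 0, le_rfl, fun i _ => by simp, Subsingleton.elim _ _⟩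
    have hg : (f * X).Monic := hf.mul monic_X
    have hdeg : (f * X).natDegree = n := by
      rw [hf.natDegree_mul monic_X, natDegree_X]
    refine ⟨n, fun i => (((f * X).coeff (n - i) : ceilRees I q hq) : R[X]).coeff (i * (p * q)),
      by omega, ?_, ?_⟩
    · intro i _
      have := mem_ceilRees.1 ((f * X).coeff (n - i)).2 (i * (p * q))
      rwa [key, pow_mul] at this
    · have hc := congrArg (fun r : R[X] => r.coeff (n * (p * q))) hev'
      simp only [coeff_zero] at hc
      rw [eval₂_eq_sum_range, hdeg, finsetSum_coeff, ← Finset.sum_range_reflect,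
        Finset.sum_range_succ'] at hc
      have e0 : (algebraMap (ceilRees I q hq) R[X] ((f * X).coeff (n + 1 - 1 - 0)) *
          monomial (p * q) (x ^ q) ^ (n + 1 - 1 - 0)).coeff (n * (p * q)) = (x ^ q) ^ n := by
        have : (f * X).coeff (n + 1 - 1 - 0) = 1 := by
          have := hg.coeff_natDegree
          rwa [hdeg] at this
        rw [this, map_one, one_mul, monomial_pow, coeff_monomial, if_pos]
        · simp
        · rw [mul_comm]; simp
      rw [e0, add_comm] at hc
      rw [Finset.range_eq_Ico] at hc
      rw [← hc]
      congr 1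
      have hr := Finset.sum_Ico_add' (fun i => (algebraMap (ceilRees I q hq) R[X]
        ((f * X).coeff (n + 1 - 1 - i)) * monomial (p * q) (x ^ q) ^ (n + 1 - 1 - i)).coeff
        (n * (p * q))) 0 n 1
      refine Eq.trans ?_ hr.symm
      refine Finset.sum_congr rfl fun i hi => ?_
      obtain ⟨hi1, hi2⟩ := Finset.mem_Icc.1 (show i ∈ Finset.Icc 1 n from hi)
      rw [Nat.add_sub_cancel, monomial_pow]
      have hsplit : n * (p * q) = i * (p * q) + p * q * (n - i) := by
        obtain ⟨k, hk⟩ := Nat.exists_eq_add_of_le hi2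
        rw [hk, Nat.add_sub_cancel_left]; ring
      rw [hsplit, coeff_mul_monomial]
      rfl

theorem isIntegralOverIdeal_iff (I : Ideal R) (x : R) :
    IsIntegralOverIdeal I x ↔ IsIntegral (ceilRees I 1 one_pos) (monomial 1 x) := by
  simpa using isIntegralOverIdeal_pow_iff I 1 1 one_pos x

theorem isIntegral_monomial_smul {I : Ideal R} {p q : ℕ} {hq : 0 < q} (r : R) {x : R}
    (hx : IsIntegral (ceilRees I q hq) (monomial p x)) :
    IsIntegral (ceilRees I q hq) (monomial p (r • x)) := by
  have h : monomial p (r • x) = algebraMap (ceilRees I q hq) R[X] (algebraMap R _ r)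
      * monomial p x := by
    rw [← IsScalarTower.algebraMap_apply, ← Algebra.smul_def, smul_monomial]
  rw [h]
  exact isIntegral_algebraMap.mul hx

/-- The integral closure of an ideal `I`: all elements integral over `I`. -/
def idealIntegralClosure (I : Ideal R) : Ideal R where
  carrier := {x | IsIntegralOverIdeal I x}
  zero_mem' := by
    change IsIntegralOverIdeal _ _
    rw [isIntegralOverIdeal_iff, map_zero]
    exact isIntegral_zero
  add_mem' := by
    intro x y hx hy
    change IsIntegralOverIdeal _ _ at hx hy ⊢
    rw [isIntegralOverIdeal_iff] at *
    rw [map_add]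
    exact hx.add hy
  smul_mem' := by
    intro r x hx
    change IsIntegralOverIdeal _ _ at hx ⊢
    rw [isIntegralOverIdeal_iff] at *
    exact isIntegral_monomial_smul r hx

/-- The `u`-th rational power of `I` for a positive rational `u`: writing `u = p / q` in lowest
terms, the ideal of all `x` such that `x ^ q` lies in the integral closure of `I ^ p`. -/
def rationalPower (I : Ideal R) (u : ℚ) : Ideal R where
  carrier := {x | x ^ u.den ∈ idealIntegralClosure (I ^ u.num.toNat)}
  zero_mem' := by
    change IsIntegralOverIdeal _ _
    rw [isIntegralOverIdeal_pow_iff _ _ _ u.den_pos, map_zero]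
    exact isIntegral_zero
  add_mem' := by
    intro x y hx hy
    change IsIntegralOverIdeal _ _ at hx hy ⊢
    rw [isIntegralOverIdeal_pow_iff _ _ _ u.den_pos] at *
    rw [map_add]
    exact hx.add hy
  smul_mem' := by
    intro r x hx
    change IsIntegralOverIdeal _ _ at hx ⊢
    rw [isIntegralOverIdeal_pow_iff _ _ _ u.den_pos] at *
    exact isIntegral_monomial_smul r hx

/-- For ideals `I` and `J`, the intersection of the contractions `J R_P ∩ R` over all associated
primes `P` of `R / I`. -/
noncomputable def contractAtAss (I J : Ideal R) : Ideal R :=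
  ⨅ (P : PrimeSpectrum R) (_ : P.asIdeal ∈ associatedPrimes R (R ⧸ I)),
    (J.map (algebraMap R (Localization.AtPrime P.asIdeal))).comap
      (algebraMap R (Localization.AtPrime P.asIdeal))

/-- The ordinary `n`-th symbolic power `I^(n)`: the intersection of `I ^ n R_P ∩ R` over
`P ∈ Ass (R / I)`. -/
noncomputable def symbolicPower (I : Ideal R) (n : ℕ) : Ideal R :=
  contractAtAss I (I ^ n)

/-- The `u`-th rational symbolic power of `I`: the intersection of the contractions to `R` of the
localizations of the rational power of exponent `u` at all `P ∈ Ass (R / I)`. -/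
noncomputable def rationalSymbolicPower (I : Ideal R) (u : ℚ) : Ideal R :=
  contractAtAss I (rationalPower I u)

end RationalSymbolic

/-! Everything is decided at the associated primes P of R/I. Since I is radical, I R_P is the
maximal ideal of R_P. The ring R_P is regular local, so its associated graded ring is a domain and
every power of its maximal ideal is integrally closed. Hence at P, integrality of x^q over I^p is
the same as x^q ∈ I^p R_P (`algebraMap_mem_map_rationalPower_iff`). Intersecting over P gives x^q ∈
I^(p), and the same local fact makes I^(p) integrally closed, which identifies all the sets.

Two facts on regular local rings carry this. `isGrDomain_maximalIdeal`: the graded ring is a domain,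
by induction on embedding dimension, dividing by one minimal generator whose initial form is a
nonzerodivisor. `isRegularLocalRing_localization`: localizations stay regular, by Serre's criterion
that regularity is finite projective dimension of the maximal ideal, a condition which localizes.
The second is needed only when R is assumed regular local. -/

namespace RationalSymbolic

/-! ### Regular sequences, graded domains and integrally closed powers -/

section GradedDomain

variable {A : Type*} [CommRing A]

/-- Ideals generated by a weakly regular sequence. -/
inductive IsRegSeqIdeal : Ideal A → Prop
  | bot : IsRegSeqIdeal ⊥
  | sup (J : Ideal A) (y : A) : IsRegSeqIdeal J → (∀ a, y * a ∈ J → a ∈ J) →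
      IsRegSeqIdeal (J ⊔ Ideal.span {y})

theorem sup_pow_succ (I K : Ideal A) (n : ℕ) :
    (I ⊔ K) ^ (n + 1) = K * (I ⊔ K) ^ n ⊔ I ^ (n + 1) := by
  apply le_antisymm
  · induction n with
    | zero => simp [sup_comm]
    | succ n ih =>
      rw [pow_succ' (I ⊔ K) (n + 1), Ideal.sup_mul, sup_comm]
      refine sup_le le_sup_left ((Ideal.mul_mono_right ih).trans ?_)
      rw [Ideal.mul_sup]
      refine sup_le (le_sup_of_le_left ?_) (le_sup_of_le_right (pow_succ' I (n + 1)).ge)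
      rw [mul_left_comm, pow_succ' (I ⊔ K) n]
      exact Ideal.mul_mono_right (Ideal.mul_mono_left le_sup_left)
  · refine sup_le ?_ (Ideal.pow_right_mono le_sup_left _)
    rw [pow_succ']
    exact Ideal.mul_mono_left le_sup_right

theorem mem_of_mem_mul {I K : Ideal A} {a : A} (h : a ∈ I * K) : a ∈ K :=
  (Ideal.mul_le_right : I * K ≤ K) h

/-- Behind this is the freeness of J^n/𝔞J^n over A/𝔞: a nonzerodivisor x on A/𝔞 stays one there. The
proof is a double induction on the generators and on n. The ideal 𝔞 is kept apart from J because it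
must stay fixed while J loses a generator. -/
theorem IsRegSeqIdeal.mem_mul_pow_of_mul_mem {J : Ideal A} (hJ : IsRegSeqIdeal J) :
    ∀ {𝔞 : Ideal A} {x : A}, J ≤ 𝔞 → (∀ a, x * a ∈ 𝔞 → a ∈ 𝔞) → ∀ (n : ℕ) (d : A),
      d ∈ J ^ n → x * d ∈ 𝔞 * J ^ n → d ∈ 𝔞 * J ^ n := by
  induction hJ with
  | bot =>
    intro 𝔞 x _ hx n d hd hxd
    rcases n with _ | n
    · simp only [pow_zero, mul_one] at hxd ⊢
      exact hx d hxd
    · have : d = 0 := by simpa [pow_succ] using hd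
      simp [this]
  | sup J y hJ hy ih =>
    have hyn : ∀ (n : ℕ) (a : A), y * a ∈ J ^ n → a ∈ J ^ n := by
      intro n
      induction n with
      | zero => simp
      | succ n ihn =>
        intro a ha
        rw [pow_succ'] at ha ⊢
        exact ih le_rfl hy n a (ihn a (mem_of_mem_mul ha)) ha
    intro 𝔞 x h𝔞 hx n
    have hJ𝔞 : J ≤ 𝔞 := le_sup_left.trans h𝔞
    have hy𝔞 : y ∈ 𝔞 := h𝔞 (Ideal.mem_sup_right (Ideal.mem_span_singleton_self y))
    induction n with
    | zero =>
      intro d _ hxd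
      simp only [pow_zero, mul_one] at hxd ⊢
      exact hx d hxd
    | succ n ihn =>
      intro d hd hxd
      set L := J ⊔ Ideal.span {y} with hL
      have hJL : J ^ (n + 1) ≤ 𝔞 * L ^ n := by
        rw [pow_succ']
        exact Ideal.mul_mono hJ𝔞 (Ideal.pow_right_mono le_sup_left n)
      rw [hL, sup_pow_succ, ← hL] at hd hxd ⊢
      rw [Ideal.mul_sup, mul_left_comm] at hxd ⊢
      obtain ⟨_, h1, e, he, rfl⟩ := Submodule.mem_sup.1 hd
      obtain ⟨c, hc, rfl⟩ := Ideal.mem_span_singleton_mul.1 h1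
      obtain ⟨_, h2, f, hf, hbf⟩ := Submodule.mem_sup.1 hxd
      obtain ⟨b, hb, rfl⟩ := Ideal.mem_span_singleton_mul.1 h2
      -- With d = yc + e and xd = yb + f, the difference y(xc - b) = f - xe lies in J^(n+1), and y
      -- cancels modulo powers of J. This separates the problem into e, settled by fewer generators,
      -- and c, settled by a smaller exponent.
      have hg : x * c - b ∈ J ^ (n + 1) := by
        refine hyn _ _ ?_
        have : y * (x * c - b) = f - x * e := by linear_combination -hbf
        rw [this]
        exact Ideal.sub_mem _ (mem_of_mem_mul hf) (Ideal.mul_mem_left _ _ he)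
      have he' : e ∈ 𝔞 * J ^ (n + 1) := by
        refine ih hJ𝔞 hx _ e he ?_
        have : x * e = f - y * (x * c - b) := by linear_combination -hbf
        rw [this]
        exact Ideal.sub_mem _ hf (Ideal.mul_mem_mul hy𝔞 hg)
      have hc' : c ∈ 𝔞 * L ^ n := by
        refine ihn c hc ?_
        have := Ideal.add_mem _ hb (hJL hg)
        rwa [add_sub_cancel] at this
      exact Ideal.add_mem _
        (Ideal.mem_sup_left (Ideal.mul_mem_mul (Ideal.mem_span_singleton_self y) hc'))
        (Ideal.mem_sup_right he')

theorem IsRegSeqIdeal.mem_pow_of_mul_mem {J : Ideal A} (hJ : IsRegSeqIdeal J) {x : A}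
    (hx : ∀ a, x * a ∈ J → a ∈ J) (n : ℕ) (a : A) (ha : x * a ∈ J ^ n) : a ∈ J ^ n := by
  induction n with
  | zero => simp
  | succ n ih =>
    rw [pow_succ'] at ha ⊢
    exact hJ.mem_mul_pow_of_mul_mem le_rfl hx n a (ih (mem_of_mem_mul ha)) ha

/-- Modulo J^(n+1), an element of (J + (x))^(n+1) is x times an element of (J + (x))^n, and x
cancels there. So the initial form of x is a nonzerodivisor of degree one. -/
theorem IsRegSeqIdeal.mem_pow_of_mul_mem_sup {J : Ideal A} (hJ : IsRegSeqIdeal J) {x : A}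
    (hx : ∀ a, x * a ∈ J → a ∈ J) (n : ℕ) (a : A)
    (ha : x * a ∈ (J ⊔ Ideal.span {x}) ^ (n + 1)) : a ∈ (J ⊔ Ideal.span {x}) ^ n := by
  rw [sup_pow_succ] at ha
  obtain ⟨_, h1, j, hj, hbj⟩ := Submodule.mem_sup.1 ha
  obtain ⟨b, hb, rfl⟩ := Ideal.mem_span_singleton_mul.1 h1
  have h : a - b ∈ J ^ (n + 1) := by
    refine hJ.mem_pow_of_mul_mem hx _ _ ?_
    have : x * (a - b) = j := by linear_combination -hbj
    rwa [this]
  have := Ideal.add_mem _ hb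
    (Ideal.pow_right_mono (le_sup_left (b := Ideal.span {x})) n (Ideal.pow_le_pow_right n.le_succ h))
  rwa [add_sub_cancel] at this

/-- The associated graded ring of the ideal `m` has no homogeneous zero divisors. -/
def IsGrDomain (m : Ideal A) : Prop :=
  ∀ (r s : ℕ) (c e : A), c ∈ m ^ r → e ∈ m ^ s → c * e ∈ m ^ (r + s + 1) →
    c ∈ m ^ (r + 1) ∨ e ∈ m ^ (s + 1)

theorem mem_map_mk_pow_iff {m : Ideal A} {x c : A} {n : ℕ} :
    Ideal.Quotient.mk (Ideal.span {x}) c ∈ (m.map (Ideal.Quotient.mk (Ideal.span {x}))) ^ n ↔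
      c ∈ m ^ n ⊔ Ideal.span {x} := by
  rw [← Ideal.map_pow, ← Ideal.mem_comap,
    Ideal.comap_map_of_surjective _ Ideal.Quotient.mk_surjective, ← RingHom.ker_eq_comap_bot,
    Ideal.mk_ker]

/-- A graded ring is a domain if it is one modulo a nonzerodivisor of degree one: in a vanishing
product one factor is divisible by that element, and dividing it out lowers the total degree r + s.
-/
theorem IsGrDomain.of_quotient {m : Ideal A} {x : A} (hxm : x ∈ m)
    (hcolon : ∀ n a, x * a ∈ m ^ (n + 1) → a ∈ m ^ n)
    (hq : IsGrDomain (m.map (Ideal.Quotient.mk (Ideal.span {x})))) : IsGrDomain m := by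
  suffices H : ∀ N r s c e, r + s = N → c ∈ m ^ r → e ∈ m ^ s → c * e ∈ m ^ (r + s + 1) →
      c ∈ m ^ (r + 1) ∨ e ∈ m ^ (s + 1) from fun r s c e => H _ r s c e rfl
  intro N
  induction N with
  | zero =>
    intro r s c e hN hc he hce
    obtain ⟨rfl, rfl⟩ : r = 0 ∧ s = 0 := by omega
    have hx : Ideal.span {x} ≤ m ^ (0 + 1) := by simpa [Ideal.span_singleton_le_iff_mem] using hxm
    have := hq 0 0 (Ideal.Quotient.mk _ c) (Ideal.Quotient.mk _ e) (by simp) (by simp)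
      (by rw [← map_mul, mem_map_mk_pow_iff]; exact Ideal.mem_sup_left hce)
    simpa only [mem_map_mk_pow_iff, sup_eq_left.2 hx] using this
  | succ N ih =>
    -- The case where the initial form of c is divisible by that of x: replace c by the quotient a,
    -- of order r - 1.
    have key : ∀ r s c e, r + s = N + 1 → c ∈ m ^ r → e ∈ m ^ s → c * e ∈ m ^ (r + s + 1) →
        c ∈ m ^ (r + 1) ⊔ Ideal.span {x} → c ∈ m ^ (r + 1) ∨ e ∈ m ^ (s + 1) := by
      intro r s c e hN hc he hce h
      rcases r with _ | r
      · have hx : Ideal.span {x} ≤ m ^ (0 + 1) := by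
          simpa [Ideal.span_singleton_le_iff_mem] using hxm
        rw [sup_eq_left.2 hx] at h
        exact Or.inl h
      obtain ⟨c', hc', _, h1, rfl⟩ := Submodule.mem_sup.1 h
      obtain ⟨a, rfl⟩ := Ideal.mem_span_singleton'.1 h1
      have ha : a ∈ m ^ r := by
        refine hcolon _ _ ?_
        have := Ideal.sub_mem _ hc (Ideal.pow_le_pow_right (r + 1).le_succ hc')
        rwa [add_sub_cancel_left, mul_comm] at this
      have hae : a * e ∈ m ^ (r + s + 1) := by
        refine hcolon _ _ ?_
        have h2 : c' * e ∈ m ^ (r + s + 1 + 1) := by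
          have := Ideal.mul_mem_mul hc' he
          rw [← pow_add] at this
          convert this using 2
          omega
        have h3 : (c' + a * x) * e ∈ m ^ (r + s + 1 + 1) := by
          convert hce using 2
          omega
        have := Ideal.sub_mem _ h3 h2
        convert this using 1
        ring
      rcases ih r s a e (by omega) ha he hae with h4 | h4
      · refine Or.inl (Ideal.add_mem _ hc' ?_)
        rw [pow_succ]
        exact Ideal.mul_mem_mul h4 hxm
      · exact Or.inr h4
    intro r s c e hN hc he hce
    have := hq r s (Ideal.Quotient.mk _ c) (Ideal.Quotient.mk _ e)
      (mem_map_mk_pow_iff.2 (Ideal.mem_sup_left hc)) (mem_map_mk_pow_iff.2 (Ideal.mem_sup_left he))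
      (by rw [← map_mul, mem_map_mk_pow_iff]; exact Ideal.mem_sup_left hce)
    rw [mem_map_mk_pow_iff, mem_map_mk_pow_iff] at this
    rcases this with h | h
    · exact key r s c e hN hc he hce h
    · exact (key s r e c (by omega) he hc (by rwa [mul_comm, add_comm s r]) h).symm

theorem IsGrDomain.mem_of_pow_mem {m : Ideal A} (hm : IsGrDomain m) {r : ℕ} {y : A}
    (hy : y ∈ m ^ r) (k : ℕ) (hk : y ^ k ∈ m ^ (r * k + 1)) : y ∈ m ^ (r + 1) := by
  induction k with
  | zero =>
    have : m = ⊤ := (Ideal.eq_top_iff_one _).2 (by simpa using hk)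
    rw [this, Ideal.top_pow]
    trivial
  | succ k ih =>
    rw [pow_succ' y] at hk
    refine (hm r (r * k) y (y ^ k) hy ?_ ?_).elim id ih
    · rw [pow_mul]; exact Ideal.pow_mem_pow hy k
    · convert hk using 2; ring

/-- If y ∈ m^r with r < n, each term a_i y^(N-i) has order at least ni + r(N-i) ≥ rN + 1, so y^N
does too, and a graded domain then forces y ∈ m^(r+1). -/
theorem IsGrDomain.mem_pow_of_isIntegralOverIdeal {m : Ideal A} (hm : IsGrDomain m) {n : ℕ} {y : A}
    (hy : IsIntegralOverIdeal (m ^ n) y) : y ∈ m ^ n := by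
  obtain ⟨N, a, _, ha, h⟩ := hy
  suffices H : ∀ r ≤ n, y ∈ m ^ r from H n le_rfl
  intro r
  induction r with
  | zero => simp
  | succ r ih =>
    intro hr
    have hyr := ih (by omega)
    refine hm.mem_of_pow_mem hyr N ?_
    rw [eq_neg_of_add_eq_zero_left h]
    refine Ideal.neg_mem_iff _ |>.2 (Ideal.sum_mem _ fun i hi => ?_)
    have h1 := Ideal.mul_mem_mul (ha i hi) (Ideal.pow_mem_pow hyr (N - i))
    rw [← pow_mul, ← pow_mul, ← pow_add] at h1
    refine Ideal.pow_le_pow_right ?_ h1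
    obtain ⟨h2, h3⟩ := Finset.mem_Icc.1 hi
    obtain ⟨k, rfl⟩ := Nat.exists_eq_add_of_le h3
    rw [Nat.add_sub_cancel_left]
    nlinarith

end GradedDomain

end RationalSymbolic

namespace RationalSymbolic

/-! ### Regular local rings: quotients by generators, domain property, graded ring -/

section RegularLocal

open IsLocalRing

variable {A : Type*} [CommRing A]

theorem map_mk_maximalIdeal [IsLocalRing A] {I : Ideal A} [IsLocalRing (A ⧸ I)] :
    (maximalIdeal A).map (Ideal.Quotient.mk I) = maximalIdeal (A ⧸ I) := by
  have hs : Function.Surjective (Ideal.Quotient.mk I) := Ideal.Quotient.mk_surjective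
  rw [← eq_maximalIdeal (Ideal.comap_isMaximal_of_surjective (Ideal.Quotient.mk I) hs
    (K := maximalIdeal (A ⧸ I))), Ideal.map_comap_of_surjective _ hs]

theorem isLocalRing_quotient [IsLocalRing A] {I : Ideal A} (hI : I ≤ maximalIdeal A) :
    IsLocalRing (A ⧸ I) :=
  have : Nontrivial (A ⧸ I) := Ideal.Quotient.nontrivial_iff.2
    fun h => (maximalIdeal.isMaximal A).ne_top (top_le_iff.1 (h ▸ hI))
  IsLocalRing.of_surjective' _ Ideal.Quotient.mk_surjective

/-- Killing t lowers the embedding dimension by at least |t| and the Krull dimension by at most |t|,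
so the two still agree. -/
theorem isRegularLocalRing_quotient [IsRegularLocalRing A] [DecidableEq A] {s t : Finset A}
    (hs : Ideal.span (s : Set A) = maximalIdeal A)
    (hcard : s.card = (maximalIdeal A).spanFinrank) (hts : t ⊆ s) :
    ∃ _ : IsRegularLocalRing (A ⧸ Ideal.span (t : Set A)),
      (maximalIdeal (A ⧸ Ideal.span (t : Set A))).spanFinrank + t.card ≤
        (maximalIdeal A).spanFinrank := by
  classical
  have hle : Ideal.span (t : Set A) ≤ maximalIdeal A := hs ▸ Ideal.span_mono (by exact_mod_cast hts)
  have := isLocalRing_quotient hle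
  have hspan : maximalIdeal (A ⧸ Ideal.span (t : Set A)) =
      Ideal.span (((s \ t).image (Ideal.Quotient.mk (Ideal.span (t : Set A))) : Finset _) :
        Set (A ⧸ Ideal.span (t : Set A))) := by
    have h1 : maximalIdeal A = Ideal.span (t : Set A) ⊔ Ideal.span ((s \ t : Finset A) : Set A) := by
      rw [← Ideal.span_union, ← Finset.coe_union, Finset.union_sdiff_of_subset hts, hs]
    rw [← map_mk_maximalIdeal, h1, Ideal.map_sup, Ideal.map_quotient_self, bot_sup_eq,
      Ideal.map_span, Finset.coe_image]
  have hrank : (maximalIdeal (A ⧸ Ideal.span (t : Set A))).spanFinrank + t.card ≤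
      (maximalIdeal A).spanFinrank := by
    have h1 := Submodule.spanFinrank_span_le_ncard_of_finite (R := A ⧸ Ideal.span (t : Set A))
      ((s \ t).image (Ideal.Quotient.mk (Ideal.span (t : Set A)))).finite_toSet
    rw [Set.ncard_coe_finset] at h1
    have h2 := h1.trans Finset.card_image_le
    have h3 := Finset.card_sdiff_add_card_eq_card hts
    rw [hspan]
    have : (Ideal.span (((s \ t).image (Ideal.Quotient.mk (Ideal.span (t : Set A))) : Finset _) :
        Set (A ⧸ Ideal.span (t : Set A)))).spanFinrank ≤ (s \ t).card := h2
    omega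
  refine ⟨IsRegularLocalRing.of_spanFinrank_maximalIdeal_le _ ?_, hrank⟩
  have hdim := ringKrullDim_le_ringKrullDim_quotient_add_card t
    (by rw [IsLocalRing.ringJacobson_eq_maximalIdeal]; exact Ideal.span_le.1 hle)
  rw [← IsRegularLocalRing.spanFinrank_maximalIdeal] at hdim
  have h4 : (((maximalIdeal (A ⧸ Ideal.span (t : Set A))).spanFinrank : ℕ) : WithBot ℕ∞) + t.card ≤
      ringKrullDim (A ⧸ Ideal.span (t : Set A)) + t.card :=
    le_trans (by exact_mod_cast hrank) hdim
  exact (ENat.WithBot.add_le_add_natCast_right_iff).1 h4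

/-- Outside the square of the maximal ideal, x has a unit coefficient on some minimal generator and
can be exchanged for it. -/
theorem exists_minimal_generators_mem [IsLocalRing A] [IsNoetherianRing A] {x : A}
    (hx : x ∈ maximalIdeal A) (hx2 : x ∉ maximalIdeal A ^ 2) :
    ∃ s : Finset A, x ∈ s ∧ Ideal.span (s : Set A) = maximalIdeal A ∧
      s.card = (maximalIdeal A).spanFinrank := by
  classical
  obtain ⟨s, hs, hspan⟩ :=
    Submodule.FG.exists_span_finset_card_eq_spanFinrank (maximalIdeal A).fg_of_isNoetherianRing
  have hspan : Ideal.span (s : Set A) = maximalIdeal A := hspan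
  have hx' := hx
  rw [← hspan] at hx'
  obtain ⟨f, hf⟩ := (Submodule.mem_span_finset'.1 hx')
  obtain ⟨i, hi⟩ : ∃ i, IsUnit (f i) := by
    by_contra! h
    refine hx2 ?_
    rw [← hf, pow_two]
    refine Ideal.sum_mem _ fun i _ => Ideal.mul_mem_mul ((mem_maximalIdeal _).2 (h i)) ?_
    rw [← hspan]
    exact Ideal.subset_span i.2
  have hspan' : Ideal.span ((insert x (s.erase i) : Finset A) : Set A) = maximalIdeal A := by
    apply le_antisymm
    · rw [Ideal.span_le]
      intro y hy
      rcases Finset.mem_insert.1 hy with rfl | hy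
      · exact hx
      · rw [← hspan]; exact Ideal.subset_span (Finset.mem_of_mem_erase hy)
    · rw [← hspan, Ideal.span_le]
      intro y hy
      by_cases hyi : y = i
      · subst hyi
        rw [SetLike.mem_coe, ← Ideal.unit_mul_mem_iff_mem _ hi]
        have h1 : f i * (i : A) = x - ∑ j ∈ Finset.univ.erase i, f j * (j : A) := by
          rw [← hf, ← Finset.add_sum_erase _ _ (Finset.mem_univ i)]
          simp [smul_eq_mul]
        rw [h1]
        refine Ideal.sub_mem _ (Ideal.subset_span (by simp)) (Ideal.sum_mem _ fun j hj =>
          Ideal.mul_mem_left _ _ (Ideal.subset_span ?_))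
        refine Finset.mem_coe.2 (Finset.mem_insert_of_mem (Finset.mem_erase.2 ⟨?_, j.2⟩))
        exact fun h => (Finset.mem_erase.1 hj).1 (Subtype.ext h)
      · exact Ideal.subset_span (Finset.mem_coe.2
          (Finset.mem_insert_of_mem (Finset.mem_erase.2 ⟨hyi, hy⟩)))
  refine ⟨_, Finset.mem_insert_self _ _, hspan', le_antisymm ?_ ?_⟩
  · rw [← hs]
    refine (Finset.card_insert_le _ _).trans ?_
    rw [Finset.card_erase_of_mem i.2]
    have := Finset.card_pos.2 ⟨_, i.2⟩
    omega
  · have := Submodule.spanFinrank_span_le_ncard_of_finite (R := A)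
      (insert x (s.erase i)).finite_toSet
    rw [Set.ncard_coe_finset] at this
    rw [← hspan']
    exact this

theorem maximalIdeal_sq_lt [IsLocalRing A] [IsNoetherianRing A] (h : maximalIdeal A ≠ ⊥) :
    ¬ maximalIdeal A ≤ maximalIdeal A ^ 2 := by
  intro hle
  refine h (Submodule.eq_bot_of_le_smul_of_le_jacobson_bot (maximalIdeal A) _
    (maximalIdeal A).fg_of_isNoetherianRing ?_ (maximalIdeal_le_jacobson _))
  rwa [smul_eq_mul, ← pow_two]

/-- Choose x in m, outside m² and all minimal primes. By induction (x) is prime, so it contains a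
minimal prime q; as x ∉ q, q = xq, and Nakayama gives q = 0. -/
theorem isDomain_of_isRegularLocalRing (A : Type*) [CommRing A] [IsRegularLocalRing A] :
    IsDomain A := by
  classical
  induction hn : (maximalIdeal A).spanFinrank using Nat.strong_induction_on generalizing A with
  | _ n ih =>
  by_cases hbot : maximalIdeal A = ⊥
  · exact (isField_iff_maximalIdeal_eq.2 hbot).isDomain
  have hmin : ∀ q ∈ minimalPrimes A, ¬ maximalIdeal A ≤ q := by
    intro q hq hle
    have : q.IsPrime := Ideal.IsMinimalPrime.isPrime hq
    have heq : maximalIdeal A = q := (maximalIdeal.isMaximal A).eq_of_le this.ne_top hle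
    have h0 : (maximalIdeal A).height = 0 := by
      rw [heq]
      exact Ideal.height_eq_zero_iff.2 hq
    have h1 := maximalIdeal_height_eq_ringKrullDim (R := A)
    rw [← IsRegularLocalRing.spanFinrank_maximalIdeal, h0] at h1
    have h2 : (maximalIdeal A).spanFinrank = 0 := by exact_mod_cast h1.symm
    exact hbot ((Submodule.spanFinrank_eq_zero_iff_eq_bot
      (maximalIdeal A).fg_of_isNoetherianRing).1 h2)
  obtain ⟨x, hx, hx'⟩ : ∃ x ∈ maximalIdeal A,
      x ∉ ⋃ i ∈ insert (maximalIdeal A ^ 2) (minimalPrimes A), ((id i : Ideal A) : Set A) := by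
    by_contra! h
    -- Prime avoidance tolerates two non-prime members; m² fills both slots.
    obtain ⟨i, hi, hle⟩ := (Ideal.subset_union_prime_finite (f := id)
      ((minimalPrimes.finite_of_isNoetherianRing A).insert (maximalIdeal A ^ 2))
      (maximalIdeal A ^ 2) (maximalIdeal A ^ 2)
      (fun i hi h1 _ => Ideal.IsMinimalPrime.isPrime (hi.resolve_left h1))).1 h
    rcases hi with rfl | hi
    · exact maximalIdeal_sq_lt hbot hle
    · exact hmin i hi hle
  simp only [Set.mem_iUnion, not_exists] at hx'
  have hx2 : x ∉ maximalIdeal A ^ 2 := hx' _ (Set.mem_insert _ _)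
  obtain ⟨s, hxs, hs, hcard⟩ := exists_minimal_generators_mem hx hx2
  obtain ⟨hreg, hlt⟩ := isRegularLocalRing_quotient hs hcard (Finset.singleton_subset_iff.2 hxs)
  have hdom := ih _ (by rw [Finset.card_singleton] at hlt; omega)
    (A ⧸ Ideal.span (({x} : Finset A) : Set A)) rfl
  rw [Ideal.Quotient.isDomain_iff_prime, Finset.coe_singleton] at hdom
  obtain ⟨q, hq, hqx⟩ := Ideal.exists_minimalPrimes_le (J := Ideal.span {x}) (bot_le (α := Ideal A))
  have hqp : q.IsPrime := Ideal.IsMinimalPrime.isPrime hq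
  have hxq : x ∉ q := hx' q (Set.mem_insert_of_mem _ hq)
  have hq0 : q = ⊥ := by
    refine Submodule.eq_bot_of_le_smul_of_le_jacobson_bot (maximalIdeal A) _
      q.fg_of_isNoetherianRing ?_ (maximalIdeal_le_jacobson _)
    intro a ha
    obtain ⟨b, rfl⟩ := Ideal.mem_span_singleton'.1 (hqx ha)
    have hb := (hqp.mem_or_mem ha).resolve_right hxq
    rw [mul_comm]
    exact Ideal.mul_mem_mul hx hb
  subst hq0
  have : NoZeroDivisors A := ⟨fun h => hqp.mem_or_mem h⟩
  exact NoZeroDivisors.to_isDomain A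

theorem isPrime_span_of_subset_generators [IsRegularLocalRing A] {s t : Finset A}
    (hs : Ideal.span (s : Set A) = maximalIdeal A)
    (hcard : s.card = (maximalIdeal A).spanFinrank) (hts : t ⊆ s) :
    (Ideal.span (t : Set A)).IsPrime := by
  classical
  obtain ⟨_, -⟩ := isRegularLocalRing_quotient hs hcard hts
  exact (Ideal.Quotient.isDomain_iff_prime _).1 (isDomain_of_isRegularLocalRing _)

theorem notMem_span_of_subset_generators [IsLocalRing A] [DecidableEq A] {s t : Finset A}
    (hs : Ideal.span (s : Set A) = maximalIdeal A)
    (hcard : s.card = (maximalIdeal A).spanFinrank) {x : A} (hx : x ∈ s) (hts : t ⊆ s.erase x) :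
    x ∉ Ideal.span (t : Set A) := by
  intro h
  have hspan : Ideal.span ((s.erase x : Finset A) : Set A) = maximalIdeal A := by
    rw [← hs]
    apply le_antisymm (Ideal.span_mono (by exact_mod_cast s.erase_subset x))
    rw [Ideal.span_le]
    intro y hy
    by_cases hyx : y = x
    · rw [hyx]
      exact Ideal.span_mono (by exact_mod_cast hts) h
    · exact Ideal.subset_span (Finset.mem_coe.2 (Finset.mem_erase.2 ⟨hyx, hy⟩))
  have h1 := Submodule.spanFinrank_span_le_ncard_of_finite (R := A) (s.erase x).finite_toSet
  rw [Set.ncard_coe_finset, Finset.card_erase_of_mem hx] at h1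
  have h2 : (maximalIdeal A).spanFinrank ≤ s.card - 1 := hspan ▸ h1
  have := Finset.card_pos.2 ⟨x, hx⟩
  omega

/-- Each partial set of minimal generators spans a prime not containing the next generator, which is
therefore regular modulo it. -/
theorem isRegSeqIdeal_span_of_subset_generators [IsRegularLocalRing A] {s t : Finset A}
    (hs : Ideal.span (s : Set A) = maximalIdeal A)
    (hcard : s.card = (maximalIdeal A).spanFinrank) (hts : t ⊆ s) :
    IsRegSeqIdeal (Ideal.span (t : Set A)) := by
  classical
  induction t using Finset.induction_on with
  | empty => simpa using IsRegSeqIdeal.bot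
  | insert y t hy ih =>
    have hts' := (Finset.subset_insert y t).trans hts
    have hys : y ∈ s := hts (Finset.mem_insert_self _ _)
    have hp := isPrime_span_of_subset_generators hs hcard hts'
    have hy' := notMem_span_of_subset_generators hs hcard hys
      (fun z hz => Finset.mem_erase.2 ⟨fun h => hy (h ▸ hz), hts' hz⟩)
    rw [Finset.coe_insert, Ideal.span_insert, sup_comm]
    exact .sup _ _ (ih hts') fun a ha => (hp.mem_or_mem ha).resolve_left hy'

theorem isGrDomain_maximalIdeal (A : Type*) [CommRing A] [IsRegularLocalRing A] :
    IsGrDomain (maximalIdeal A) := by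
  classical
  induction hn : (maximalIdeal A).spanFinrank using Nat.strong_induction_on generalizing A with
  | _ n ih =>
  obtain ⟨s, hcard, hs⟩ :=
    Submodule.FG.exists_span_finset_card_eq_spanFinrank (maximalIdeal A).fg_of_isNoetherianRing
  have hs : Ideal.span (s : Set A) = maximalIdeal A := hs
  rcases s.eq_empty_or_nonempty with rfl | ⟨x, hx⟩
  · have hbot : maximalIdeal A = ⊥ := by rw [← hs]; simp
    have hA := isDomain_of_isRegularLocalRing A
    intro r e c e' hc he hce
    have h0 : c * e' = 0 := by simpa [hbot, pow_succ] using hce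
    rcases mul_eq_zero.1 h0 with rfl | rfl
    · exact Or.inl (zero_mem _)
    · exact Or.inr (zero_mem _)
  have hxm : x ∈ maximalIdeal A := hs ▸ Ideal.subset_span hx
  have hsub := s.erase_subset x
  have hp := isPrime_span_of_subset_generators hs hcard hsub
  have hxn := notMem_span_of_subset_generators hs hcard hx (Finset.Subset.refl _)
  have hm : maximalIdeal A = Ideal.span ((s.erase x : Finset A) : Set A) ⊔ Ideal.span {x} := by
    rw [sup_comm, ← Ideal.span_insert, ← Finset.coe_insert, Finset.insert_erase hx, hs]
  refine IsGrDomain.of_quotient hxm ?_ ?_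
  · rw [hm]
    exact (isRegSeqIdeal_span_of_subset_generators hs hcard hsub).mem_pow_of_mul_mem_sup
      fun a ha => (hp.mem_or_mem ha).resolve_left hxn
  · obtain ⟨hreg, hlt⟩ := isRegularLocalRing_quotient hs hcard (Finset.singleton_subset_iff.2 hx)
    have := ih _ (by rw [Finset.card_singleton] at hlt; omega)
      (A ⧸ Ideal.span (({x} : Finset A) : Set A)) rfl
    rw [← map_mk_maximalIdeal] at this
    rwa [Finset.coe_singleton] at this

theorem mem_maximalIdeal_pow_of_isIntegralOverIdeal [IsRegularLocalRing A] {n : ℕ} {y : A}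
    (hy : IsIntegralOverIdeal (maximalIdeal A ^ n) y) : y ∈ maximalIdeal A ^ n :=
  (isGrDomain_maximalIdeal A).mem_pow_of_isIntegralOverIdeal hy

end RegularLocal

end RationalSymbolic

namespace RationalSymbolic

/-! ### Serre's criterion and localization of regularity -/

section ProjectiveDimension

open IsLocalRing CategoryTheory

universe u

variable {A : Type u} [CommRing A]

variable (A) in
/-- The projective dimension of the `A`-module `N` is at most `n`. -/
abbrev ProjDimLE (N : Type u) [AddCommGroup N] [Module A N] (n : ℕ) : Prop :=
  HasProjectiveDimensionLE (ModuleCat.of A N) n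

theorem projDimLE_zero_iff {N : Type u} [AddCommGroup N] [Module A N] :
    ProjDimLE A N 0 ↔ Module.Projective A N := by
  rw [ProjDimLE, ← projective_iff_hasProjectiveDimensionLE_zero, ← IsProjective.iff_projective]

theorem projDimLE_succ_iff_of_exact {K P N : Type u} [AddCommGroup K] [Module A K]
    [AddCommGroup P] [Module A P] [AddCommGroup N] [Module A N] [Module.Projective A P]
    {i : K →ₗ[A] P} {f : P →ₗ[A] N} (hi : Function.Injective i) (hif : Function.Exact i f)
    (hf : Function.Surjective f) (n : ℕ) : ProjDimLE A N (n + 1) ↔ ProjDimLE A K n := by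
  have hS := ModuleCat.shortComplex_shortExact
    (ModuleCat.shortComplexOfCompEqZero i f hif.linearMap_comp_eq_zero) hif hi hf
  exact hS.hasProjectiveDimensionLT_X₃_iff n
    (inferInstanceAs (Projective (ModuleCat.of A P)))

theorem projDimLE_of_retract {M N : Type u} [AddCommGroup M] [Module A M] [AddCommGroup N]
    [Module A N] (i : M →ₗ[A] N) (r : N →ₗ[A] M) (h : r ∘ₗ i = LinearMap.id) {n : ℕ}
    (hN : ProjDimLE A N n) : ProjDimLE A M n :=
  let e : Retract (ModuleCat.of A M) (ModuleCat.of A N) :=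
    { i := ModuleCat.ofHom i, r := ModuleCat.ofHom r
      retract := by rw [← ModuleCat.ofHom_comp, h]; rfl }
  e.hasProjectiveDimensionLT (n + 1)

/-- Induction along syzygies: x is regular on N, so a presentation of N remains exact modulo x. At n
= 0, freeness can be tested modulo x. -/
theorem projDimLE_iff_quotSMulTop [IsLocalRing A] [IsNoetherianRing A] {x : A}
    (hx : x ∈ maximalIdeal A) (hxA : x ∈ nonZeroDivisors A) (n : ℕ) (N : Type u) [AddCommGroup N]
    [Module A N] [Module.Finite A N] (hxN : IsSMulRegular N x) :
    ProjDimLE A N n ↔ ProjDimLE (A ⧸ Ideal.span {x}) (QuotSMulTop x N) n := by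
  induction n generalizing N with
  | zero =>
    have := isLocalRing_quotient ((Ideal.span_singleton_le_iff_mem _).2 hx)
    have : Module.Finite (A ⧸ Ideal.span {x}) (QuotSMulTop x N) :=
      Module.Finite.of_restrictScalars_finite A _ _
    have := Module.finitePresentation_of_finite A N
    rw [projDimLE_zero_iff, projDimLE_zero_iff]
    have h := Module.free_quotSMulTop_iff_free A N (maximalIdeal_le_jacobson _ hx) hxN
    constructor
    · intro hp
      have : Module.Free A N := Module.free_of_flat_of_isLocalRing
      have := h.2 this
      infer_instance
    · intro hp
      have : Module.Free (A ⧸ Ideal.span {x}) (QuotSMulTop x N) :=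
        Module.free_of_flat_of_isLocalRing
      have := h.1 this
      infer_instance
  | succ n ih =>
    obtain ⟨P, _, _, _, _, f, hf⟩ := Module.exists_finite_presentation A N
    have hxP : IsSMulRegular P x := Module.Flat.isSMulRegular_of_nonZeroDivisors hxA
    have hxK : IsSMulRegular (LinearMap.ker f) x := hxP.submodule _ _
    rw [projDimLE_succ_iff_of_exact (LinearMap.ker f).injective_subtype
      (LinearMap.exact_subtype_ker_map f) hf n, ih _ hxK]
    have hs : Function.Surjective (algebraMap A (A ⧸ Ideal.span {x})) :=
      Ideal.Quotient.mk_surjective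
    have hinj : Function.Injective (QuotSMulTop.map x (LinearMap.ker f).subtype) := by
      have h0 : Function.Exact (0 : LinearMap.ker f →ₗ[A] LinearMap.ker f)
          (LinearMap.ker f).subtype := by
        rw [LinearMap.exact_zero_iff_injective]
        exact (LinearMap.ker f).injective_subtype
      have := QuotSMulTop.map_first_exact_on_four_term_exact_of_isSMulRegular_last h0
        (LinearMap.exact_subtype_ker_map f) hxN
      rw [map_zero, LinearMap.exact_zero_iff_injective] at this
      exact this
    symm
    exact projDimLE_succ_iff_of_exact
      (i := (QuotSMulTop.map x (LinearMap.ker f).subtype).extendScalarsOfSurjective hs)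
      (f := (QuotSMulTop.map x f).extendScalarsOfSurjective hs) hinj
      (QuotSMulTop.map_exact x (LinearMap.exact_subtype_ker_map f) hf)
      (QuotSMulTop.map_surjective x hf) n

/-- A first syzygy embeds in a free module, so x is regular on it and its projective dimension is
computed over A/x. Each minimal generator costs one in the bound. -/
theorem exists_forall_projDimLE (A : Type u) [CommRing A] [IsRegularLocalRing A] :
    ∃ n, ∀ (N : Type u) [AddCommGroup N] [Module A N] [Module.Finite A N], ProjDimLE A N n := by
  classical
  induction hn : (maximalIdeal A).spanFinrank using Nat.strong_induction_on generalizing A with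
  | _ d ih =>
  have hA := isDomain_of_isRegularLocalRing A
  obtain ⟨s, hcard, hs⟩ :=
    Submodule.FG.exists_span_finset_card_eq_spanFinrank (maximalIdeal A).fg_of_isNoetherianRing
  have hs : Ideal.span (s : Set A) = maximalIdeal A := hs
  rcases s.eq_empty_or_nonempty with rfl | ⟨x, hx⟩
  · have hbot : maximalIdeal A = ⊥ := by rw [← hs]; simp
    refine ⟨0, fun N _ _ _ => projDimLE_zero_iff.2 ?_⟩
    let := (isField_iff_maximalIdeal_eq.2 hbot).toField
    have := Module.finitePresentation_of_finite A N
    have : Module.Free A N := by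
      refine Module.free_of_maximalIdeal_rTensor_injective ?_
      have : Subsingleton (maximalIdeal A) := by rw [hbot]; infer_instance
      exact Function.injective_of_subsingleton _
    infer_instance
  have hxm : x ∈ maximalIdeal A := hs ▸ Ideal.subset_span hx
  have hx0 : x ≠ 0 := by
    rintro rfl
    exact notMem_span_of_subset_generators hs hcard hx (Finset.Subset.refl _) (zero_mem _)
  obtain ⟨hreg, hlt⟩ := isRegularLocalRing_quotient hs hcard (Finset.singleton_subset_iff.2 hx)
  obtain ⟨n, hn⟩ := ih _ (by rw [Finset.card_singleton] at hlt; omega)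
    (A ⧸ Ideal.span (({x} : Finset A) : Set A)) rfl
  rw [Finset.coe_singleton] at hn
  refine ⟨n + 1, fun N _ _ _ => ?_⟩
  obtain ⟨P, _, _, _, _, f, hf⟩ := Module.exists_finite_presentation A N
  have hxA : x ∈ nonZeroDivisors A := mem_nonZeroDivisors_of_ne_zero hx0
  have hxP : IsSMulRegular P x := Module.Flat.isSMulRegular_of_nonZeroDivisors hxA
  rw [projDimLE_succ_iff_of_exact (LinearMap.ker f).injective_subtype
      (LinearMap.exact_subtype_ker_map f) hf n,
    projDimLE_iff_quotSMulTop hxm hxA _ _ (hxP.submodule _ _)]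
  have : Module.Finite (A ⧸ Ideal.span {x}) (QuotSMulTop x (LinearMap.ker f)) :=
    Module.Finite.of_restrictScalars_finite A _ _
  exact hn _

open scoped TensorProduct in
theorem one_tmul_residueField_eq_zero_iff [IsLocalRing A] {N : Type u} [AddCommGroup N]
    [Module A N] (y : N) :
    (1 : ResidueField A) ⊗ₜ[A] y = 0 ↔ y ∈ maximalIdeal A • (⊤ : Submodule A N) := by
  have h : (1 : A ⧸ maximalIdeal A) ⊗ₜ[A] y = 0 ↔ y ∈ maximalIdeal A • (⊤ : Submodule A N) := by
    rw [← (TensorProduct.quotTensorEquivQuotSMul N (maximalIdeal A)).map_eq_zero_iff,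
      ← map_one (Ideal.Quotient.mk (maximalIdeal A)),
      TensorProduct.quotTensorEquivQuotSMul_mk_tmul, one_smul, Submodule.Quotient.mk_eq_zero]
  exact h

/-- Depth zero case of Auslander–Buchsbaum. Elements of the free syzygy K lying in mP are killed by
s, so their coordinates are non-units and they lie in mK. Thus K → P stays injective over the
residue field, and N is free. -/
theorem free_of_projDimLE [IsLocalRing A] [IsNoetherianRing A] {s : A} (hs0 : s ≠ 0)
    (hs : ∀ a ∈ maximalIdeal A, s * a = 0) (n : ℕ) (N : Type u) [AddCommGroup N] [Module A N]
    [Module.Finite A N] (hN : ProjDimLE A N n) : Module.Free A N := by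
  induction n generalizing N with
  | zero =>
    have := projDimLE_zero_iff.1 hN
    exact Module.free_of_flat_of_isLocalRing
  | succ n ih =>
    obtain ⟨P, _, _, _, _, f, hf⟩ := Module.exists_finite_presentation A N
    rw [projDimLE_succ_iff_of_exact (LinearMap.ker f).injective_subtype
      (LinearMap.exact_subtype_ker_map f) hf n] at hN
    have hK := ih _ hN
    refine Module.free_of_lTensor_residueField_injective _ _ hf
      (LinearMap.exact_subtype_ker_map f) ?_
    rw [injective_iff_map_eq_zero]
    intro z hz
    obtain ⟨y, rfl⟩ := TensorProduct.mk_surjective A (LinearMap.ker f) (ResidueField A)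
      Ideal.Quotient.mk_surjective z
    rw [TensorProduct.mk_apply] at hz ⊢
    rw [LinearMap.lTensor_tmul, one_tmul_residueField_eq_zero_iff] at hz
    rw [one_tmul_residueField_eq_zero_iff]
    have hsy : s • y = 0 := by
      apply Subtype.ext
      refine Submodule.smul_induction_on (p := fun w => s • w = 0) hz ?_ ?_
      · intro a ha w _
        rw [smul_smul, hs a ha, zero_smul]
      · intro v w hv hw
        rw [smul_add, hv, hw, add_zero]
    let b := Module.Free.chooseBasis A (LinearMap.ker f)
    rw [← b.sum_repr y]
    refine Submodule.sum_mem _ fun i _ => Submodule.smul_mem_smul ?_ trivial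
    rw [mem_maximalIdeal, mem_nonunits_iff]
    intro hu
    have : s * b.repr y i = 0 := by
      have := congrArg (fun w => b.repr w i) hsy
      simpa using this
    exact hs0 ((hu.mul_left_eq_zero).1 this)

/-- The maximal ideal m/(x) of A/x is a direct summand of m/xm, whose projective dimension over A/x
is bounded by change of rings. The section lifts through the ideal J of the other minimal
generators. -/
theorem projDimLE_maximalIdeal_quotient [IsLocalRing A] [IsNoetherianRing A] {x : A}
    [IsLocalRing (A ⧸ Ideal.span {x})]
    (hx : x ∈ maximalIdeal A) (hx2 : x ∉ maximalIdeal A ^ 2) (hxA : x ∈ nonZeroDivisors A) {n : ℕ}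
    (hm : ProjDimLE A (maximalIdeal A) n) :
    ProjDimLE (A ⧸ Ideal.span {x}) (maximalIdeal (A ⧸ Ideal.span {x})) n := by
  classical
  obtain ⟨s, hxs, hs, hcard⟩ := exists_minimal_generators_mem hx hx2
  have hxJ := notMem_span_of_subset_generators hs hcard hxs (Finset.Subset.refl _)
  set J := Ideal.span ((s.erase x : Finset A) : Set A) with hJ
  have hmJ : J ⊔ Ideal.span {x} = maximalIdeal A := by
    rw [sup_comm, hJ, ← Ideal.span_insert, ← Finset.coe_insert, Finset.insert_erase hxs, hs]
  have hJm : J ≤ maximalIdeal A := hmJ ▸ le_sup_left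
  have hxm : IsSMulRegular (maximalIdeal A) x :=
    (Module.Flat.isSMulRegular_of_nonZeroDivisors hxA : IsSMulRegular A x).submodule _ _
  rw [projDimLE_iff_quotSMulTop hx hxA _ _ hxm] at hm
  have hmem : ∀ y ∈ maximalIdeal A,
      Ideal.Quotient.mk (Ideal.span {x}) y ∈ maximalIdeal (A ⧸ Ideal.span {x}) := by
    intro y hy
    rw [← map_mk_maximalIdeal]
    exact Ideal.mem_map_of_mem _ hy
  let p : maximalIdeal A →ₗ[A] maximalIdeal (A ⧸ Ideal.span {x}) :=
    { toFun := fun y => ⟨Ideal.Quotient.mk _ y, hmem y y.2⟩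
      map_add' := fun _ _ => rfl
      map_smul' := fun _ _ => rfl }
  have hpx : ∀ y, p y = 0 ↔ (y : A) ∈ Ideal.span {x} := by
    intro y
    rw [← Ideal.Quotient.eq_zero_iff_mem, Subtype.ext_iff]
    rfl
  let π : QuotSMulTop x (maximalIdeal A) →ₗ[A] maximalIdeal (A ⧸ Ideal.span {x}) :=
    Submodule.liftQ _ p (by
      intro y hy
      obtain ⟨z, _, rfl⟩ := (Submodule.mem_smul_pointwise_iff_exists _ _ _).1 hy
      rw [LinearMap.mem_ker, hpx]
      exact Ideal.mul_mem_right _ _ (Ideal.mem_span_singleton_self x))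
  let i : J →ₗ[A] maximalIdeal A := Submodule.inclusion hJm
  let β : J →ₗ[A] QuotSMulTop x (maximalIdeal A) := (Submodule.mkQ _) ∘ₗ i
  have hpi : Function.Surjective (p ∘ₗ i) := by
    rintro ⟨y, hy⟩
    obtain ⟨y, rfl⟩ := Ideal.Quotient.mk_surjective y
    have hy' : y ∈ maximalIdeal A := by
      rw [← map_mk_maximalIdeal] at hy
      have := Ideal.mem_comap.2 hy
      rwa [Ideal.comap_map_of_surjective _ Ideal.Quotient.mk_surjective, ← RingHom.ker_eq_comap_bot,
        Ideal.mk_ker, sup_eq_left.2 ((Ideal.span_singleton_le_iff_mem _).2 hx)] at this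
    rw [← hmJ] at hy'
    obtain ⟨j, hj, c, hc, rfl⟩ := Submodule.mem_sup.1 hy'
    refine ⟨⟨j, hj⟩, Subtype.ext ?_⟩
    change Ideal.Quotient.mk _ j = Ideal.Quotient.mk _ (j + c)
    rw [map_add, Ideal.Quotient.eq_zero_iff_mem.2 hc, add_zero]
  -- J ∩ (x) ⊆ xm: if xa ∈ J with a a unit, then x ∈ J, contradicting minimality.
  have hker : LinearMap.ker (p ∘ₗ i) ≤ LinearMap.ker β := by
    intro j hj
    rw [LinearMap.mem_ker, LinearMap.comp_apply, hpx] at hj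
    obtain ⟨a, ha⟩ := Ideal.mem_span_singleton.1 hj
    have ha' : (j : A) = x * a := ha
    have ham : a ∈ maximalIdeal A := by
      rw [mem_maximalIdeal, mem_nonunits_iff]
      intro hu
      refine hxJ ((Ideal.mul_unit_mem_iff_mem J hu).1 ?_)
      rw [← ha']
      exact j.2
    rw [LinearMap.mem_ker]
    refine (Submodule.Quotient.mk_eq_zero _).2 ?_
    have : i j = x • (⟨a, ham⟩ : maximalIdeal A) := Subtype.ext ha
    rw [this]
    exact Submodule.smul_mem_pointwise_smul _ _ _ trivial
  let σ : maximalIdeal (A ⧸ Ideal.span {x}) →ₗ[A] QuotSMulTop x (maximalIdeal A) :=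
    (Submodule.liftQ _ β hker) ∘ₗ ((p ∘ₗ i).quotKerEquivOfSurjective hpi).symm.toLinearMap
  have hσ : ∀ j, σ ((p ∘ₗ i) j) = β j := by
    intro j
    have : ((p ∘ₗ i).quotKerEquivOfSurjective hpi).symm ((p ∘ₗ i) j) =
        Submodule.Quotient.mk j := by
      rw [LinearEquiv.symm_apply_eq]
      rfl
    change Submodule.liftQ _ β hker
      (((p ∘ₗ i).quotKerEquivOfSurjective hpi).symm ((p ∘ₗ i) j)) = _
    rw [this]
    rfl
  have hsurj : Function.Surjective (algebraMap A (A ⧸ Ideal.span {x})) :=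
    Ideal.Quotient.mk_surjective
  refine projDimLE_of_retract (σ.extendScalarsOfSurjective hsurj)
    (π.extendScalarsOfSurjective hsurj) ?_ hm
  ext1 z
  obtain ⟨j, rfl⟩ := hpi z
  change π (σ _) = _
  rw [hσ]
  rfl

theorem spanFinrank_maximalIdeal_le_quotient_add_one [IsLocalRing A] [IsNoetherianRing A] {x : A}
    [IsLocalRing (A ⧸ Ideal.span {x})] :
    (maximalIdeal A).spanFinrank ≤ (maximalIdeal (A ⧸ Ideal.span {x})).spanFinrank + 1 := by
  classical
  obtain ⟨t, hcard, ht⟩ := Submodule.FG.exists_span_finset_card_eq_spanFinrank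
    (maximalIdeal (A ⧸ Ideal.span {x})).fg_of_isNoetherianRing
  have ht : Ideal.span (t : Set (A ⧸ Ideal.span {x})) = maximalIdeal (A ⧸ Ideal.span {x}) := ht
  obtain ⟨T, hTt, hTc⟩ : ∃ T : Finset A, T.image (Ideal.Quotient.mk (Ideal.span {x})) = t ∧
      T.card ≤ t.card := by
    refine ⟨t.image (Function.surjInv Ideal.Quotient.mk_surjective), ?_, Finset.card_image_le⟩
    rw [Finset.image_image, show Ideal.Quotient.mk (Ideal.span {x}) ∘ Function.surjInv _ = id from
      funext (Function.surjInv_eq Ideal.Quotient.mk_surjective), Finset.image_id]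
  have hm : maximalIdeal A = Ideal.span ((insert x T : Finset A) : Set A) := by
    have h1 : (maximalIdeal (A ⧸ Ideal.span {x})).comap (Ideal.Quotient.mk (Ideal.span {x})) =
        maximalIdeal A := eq_maximalIdeal
      (Ideal.comap_isMaximal_of_surjective _ Ideal.Quotient.mk_surjective)
    rw [← h1, ← ht, ← hTt, Finset.coe_image, ← Ideal.map_span,
      Ideal.comap_map_of_surjective _ Ideal.Quotient.mk_surjective, ← RingHom.ker_eq_comap_bot,
      Ideal.mk_ker, Finset.coe_insert, Ideal.span_insert, sup_comm]
  have h2 := Submodule.spanFinrank_span_le_ncard_of_finite (R := A) (insert x T).finite_toSet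
  rw [Set.ncard_coe_finset] at h2
  have h3 : (maximalIdeal A).spanFinrank ≤ (insert x T).card := hm ▸ h2
  have := Finset.card_insert_le x T
  omega

/-- If m is killed by some s ≠ 0, it is free, hence zero. Otherwise some x ∈ m outside m² is
regular; A/x inherits the hypothesis in dimension one less, and embedding dimension grows by at most
one on returning to A. -/
theorem isRegularLocalRing_of_projDimLE (A : Type u) [CommRing A] [IsLocalRing A]
    [IsNoetherianRing A] {n : ℕ} (hm : ProjDimLE A (maximalIdeal A) n) : IsRegularLocalRing A := by
  -- The bound is strict so that the base case d = 0 is vacuous.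
  obtain ⟨d, hd⟩ : ∃ d : ℕ, ringKrullDim A < d := by
    have h := maximalIdeal_height_eq_ringKrullDim (R := A)
    obtain ⟨k, hk⟩ := ENat.ne_top_iff_exists.1
      (Ideal.height_ne_top (maximalIdeal.isMaximal A).ne_top)
    refine ⟨k + 1, ?_⟩
    rw [← h, ← hk]
    exact_mod_cast Nat.lt_succ_self k
  induction d generalizing A with
  | zero => exact absurd hd (not_lt.2 ringKrullDim_nonneg_of_nontrivial)
  | succ d ih =>
    by_cases hsoc : ∃ s : A, s ≠ 0 ∧ ∀ a ∈ maximalIdeal A, s * a = 0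
    · obtain ⟨s, hs0, hs⟩ := hsoc
      have hfree := free_of_projDimLE hs0 hs n _ hm
      have hbot : maximalIdeal A = ⊥ := by
        by_contra hne
        have : Nontrivial (maximalIdeal A) := Submodule.nontrivial_iff_ne_bot.2 hne
        have h1 : s ∈ Module.annihilator A (maximalIdeal A) :=
          Module.mem_annihilator.2 fun a => Subtype.ext (hs a a.2)
        rw [Module.annihilator_eq_bot.2 inferInstance] at h1
        exact hs0 h1
      refine IsRegularLocalRing.of_spanFinrank_maximalIdeal_le _ ?_
      rw [hbot, Submodule.spanFinrank_bot]
      exact ringKrullDim_nonneg_of_nontrivial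
    have hbot : maximalIdeal A ≠ ⊥ := by
      intro hbot
      refine hsoc ⟨1, one_ne_zero, fun a ha => ?_⟩
      rw [hbot] at ha
      simpa using ha
    obtain ⟨x, hx, hx'⟩ : ∃ x ∈ maximalIdeal A,
        x ∉ ⋃ i ∈ insert (maximalIdeal A ^ 2) (associatedPrimes A A), ((id i : Ideal A) : Set A) := by
      by_contra! h
      obtain ⟨i, hi, hle⟩ := (Ideal.subset_union_prime_finite (f := id)
        ((associatedPrimes.finite A A).insert (maximalIdeal A ^ 2))
        (maximalIdeal A ^ 2) (maximalIdeal A ^ 2)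
        (fun i hi h1 _ => (hi.resolve_left h1).1)).1 h
      rcases hi with rfl | hi
      · exact maximalIdeal_sq_lt hbot hle
      · obtain ⟨hp, s, hs⟩ := Submodule.isAssociatedPrime_iff.1 hi
        refine hsoc ⟨s, ?_, fun a ha => ?_⟩
        · rintro rfl
          refine hp.ne_top ?_
          rw [hs]
          simp
        · have h2 : a ∈ i := hle ha
          rw [hs, Submodule.mem_colon_singleton, Submodule.mem_bot, smul_eq_mul] at h2
          rw [mul_comm, h2]
    simp only [Set.mem_iUnion, not_exists] at hx'
    have hx2 : x ∉ maximalIdeal A ^ 2 := hx' _ (Set.mem_insert _ _)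
    have hxreg : IsSMulRegular A x := by
      have h1 : x ∉ ⋃ p ∈ associatedPrimes A A, (p : Set A) := by
        simp only [Set.mem_iUnion, not_exists]
        exact fun p hp => hx' p (Set.mem_insert_of_mem _ hp)
      rw [biUnion_associatedPrimes_eq_compl_regular] at h1
      exact not_not.1 h1
    have hxA : x ∈ nonZeroDivisors A := by
      rw [mem_nonZeroDivisors_iff_right]
      intro y hy
      exact hxreg.right_eq_zero_of_smul (by rwa [smul_eq_mul, mul_comm])
    have := isLocalRing_quotient ((Ideal.span_singleton_le_iff_mem _).2 hx)
    have hdim := ringKrullDim_quotient_span_singleton_succ_eq_ringKrullDim hxreg hx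
    have hreg := ih (A ⧸ Ideal.span {x}) (projDimLE_maximalIdeal_quotient hx hx2 hxA hm) (by
      by_contra! h
      refine not_le.2 hd ?_
      rw [← hdim, Nat.cast_add, Nat.cast_one]
      gcongr)
    refine IsRegularLocalRing.of_spanFinrank_maximalIdeal_le _ ?_
    rw [← hdim, ← IsRegularLocalRing.spanFinrank_maximalIdeal]
    exact_mod_cast spanFinrank_maximalIdeal_le_quotient_add_one

/-- P has finite projective dimension over A; localizing gives the same bound for the maximal ideal
of the local ring at P. -/
theorem isRegularLocalRing_localization (A : Type u) [CommRing A] [IsRegularLocalRing A]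
    (P : Ideal A) [P.IsPrime] : IsRegularLocalRing (Localization.AtPrime P) := by
  obtain ⟨n, hn⟩ := exists_forall_projDimLE A
  have hP : HasProjectiveDimensionLE (ModuleCat.of A P) n := hn P
  have h1 := ModuleCat.localizedModule_hasProjectiveDimensionLE n P.primeCompl (ModuleCat.of A P)
  have hnoeth : IsNoetherianRing (Localization.AtPrime P) :=
    IsLocalization.isNoetherianRing P.primeCompl _ inferInstance
  refine isRegularLocalRing_of_projDimLE (n := n) _ ?_
  have := ModuleCat.localizedModule_isLocalizedModule (ModuleCat.of A P) P.primeCompl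
  let e := IsLocalizedModule.linearEquiv P.primeCompl
    ((ModuleCat.of A P).localizedModuleMkLinearMap P.primeCompl)
    (Algebra.idealMap (Localization.AtPrime P) P)
  let e' := e.extendScalarsOfIsLocalization P.primeCompl (Localization.AtPrime P)
  have h2 : ProjDimLE (Localization.AtPrime P) (P.map (algebraMap A (Localization.AtPrime P))) n :=
    ModuleCat.hasProjectiveDimensionLE_of_linearEquiv e' n
  rwa [Localization.AtPrime.map_eq_maximalIdeal] at h2

end ProjectiveDimension

end RationalSymbolic

namespace RationalSymbolic

/-! ### Rational powers, local comparison and symbolic powers -/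

section Symbolic

open IsLocalRing

variable {R : Type*} [CommRing R]

theorem isIntegralOverIdeal_of_mem {J : Ideal R} {x : R} (hx : x ∈ J) :
    IsIntegralOverIdeal J x :=
  ⟨1, fun _ => -x, le_rfl, fun i hi => by
    obtain rfl : i = 1 := by simpa using hi
    simpa using hx, by simp⟩

/-- Over the Rees algebra, zT is integral exactly when (zT)^c is. This makes rational powers
independent of the fraction chosen for the exponent. -/
theorem isIntegralOverIdeal_pow_pow_iff (K : Ideal R) {c : ℕ} (hc : 0 < c) (z : R) :
    IsIntegralOverIdeal (K ^ c) (z ^ c) ↔ IsIntegralOverIdeal K z := by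
  have h := isIntegralOverIdeal_pow_iff K c 1 one_pos (z ^ c)
  rw [pow_one] at h
  have h1 : Polynomial.monomial c (z ^ c) = Polynomial.monomial 1 z ^ c := by
    rw [Polynomial.monomial_pow, one_mul]
  rw [h, h1, isIntegralOverIdeal_iff]
  exact ⟨fun h => h.of_pow hc, fun h => h.pow c⟩

theorem mem_rationalPower_div_iff (J : Ideal R) {p q : ℕ} (hp : 0 < p) (hq : 0 < q) (x : R) :
    x ∈ rationalPower J ((p : ℚ) / q) ↔ IsIntegralOverIdeal (J ^ p) (x ^ q) := by
  -- c is the common factor removed in passing to lowest terms.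
  obtain ⟨c, hpc, hqc⟩ := Rat.exists_eq_mul_div_num_and_eq_mul_div_den (p : ℤ) (d := (q : ℤ))
    (by exact_mod_cast hq.ne')
  simp only [Int.cast_natCast] at hpc hqc
  set u : ℚ := (p : ℚ) / q with hu
  have hden : (0 : ℤ) < u.den := by exact_mod_cast u.den_pos
  have hc : 0 < c := by
    have : 0 < c * (u.den : ℤ) := by rw [← hqc]; exact_mod_cast hq
    exact (pos_iff_pos_of_mul_pos this).2 hden
  have hnum : 0 ≤ u.num := Rat.num_nonneg.2 (by positivity)
  lift c to ℕ using hc.le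
  have hc' : 0 < c := by exact_mod_cast hc
  have h1 : p = u.num.toNat * c := by
    zify
    rw [Int.toNat_of_nonneg hnum, mul_comm, ← hpc]
  have h2 : q = u.den * c := by
    zify
    rw [mul_comm, ← hqc]
  have h3 : IsIntegralOverIdeal (J ^ p) (x ^ q) ↔
      IsIntegralOverIdeal (J ^ u.num.toNat) (x ^ u.den) := by
    rw [h1, h2, pow_mul, pow_mul, isIntegralOverIdeal_pow_pow_iff _ hc']
  rw [h3]
  rfl

theorem IsIntegralOverIdeal.map {S : Type*} [CommRing S] (f : R →+* S) {J : Ideal R} {x : R}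
    (hx : IsIntegralOverIdeal J x) : IsIntegralOverIdeal (J.map f) (f x) := by
  obtain ⟨n, a, hn, ha, h⟩ := hx
  refine ⟨n, fun i => f (a i), hn, fun i hi => ?_, ?_⟩
  · rw [← Ideal.map_pow]
    exact Ideal.mem_map_of_mem f (ha i hi)
  · simpa using congrArg f h

theorem IsIntegralOverIdeal.mono {J K : Ideal R} (hJK : J ≤ K) {x : R}
    (hx : IsIntegralOverIdeal J x) : IsIntegralOverIdeal K x := by
  obtain ⟨n, a, hn, ha, h⟩ := hx
  exact ⟨n, a, hn, fun i hi => Ideal.pow_right_mono hJK i (ha i hi), h⟩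

/-- Write P = (I : y). If y ∈ P then y² ∈ I, so y ∈ I by radicality and P = R. Hence y is a unit at
P, and yP ⊆ I gives the equality there. -/
theorem map_eq_maximalIdeal_of_mem_associatedPrimes [IsNoetherianRing R] {I : Ideal R}
    (hI : I.IsRadical) {P : Ideal R} [hP : P.IsPrime] (hPI : P ∈ associatedPrimes R (R ⧸ I)) :
    I.map (algebraMap R (Localization.AtPrime P)) = maximalIdeal (Localization.AtPrime P) := by
  obtain ⟨-, y, hy⟩ := Submodule.isAssociatedPrime_iff.1 hPI
  obtain ⟨y, rfl⟩ := Ideal.Quotient.mk_surjective y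
  have hmem : ∀ a, a ∈ P ↔ a * y ∈ I := by
    intro a
    rw [hy, Submodule.mem_colon_singleton, Submodule.mem_bot, ← Ideal.Quotient.eq_zero_iff_mem,
      map_mul]
    rfl
  have hIP : I ≤ P := fun a ha => (hmem a).2 (Ideal.mul_mem_right _ _ ha)
  have hyP : y ∉ P := by
    intro h
    have hyI : y ∈ I := hI ⟨2, by rw [pow_two]; exact (hmem y).1 h⟩
    exact hP.ne_top ((Ideal.eq_top_iff_one _).2 ((hmem 1).2 (by rwa [one_mul])))
  rw [← Localization.AtPrime.map_eq_maximalIdeal]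
  refine le_antisymm (Ideal.map_mono hIP) (Ideal.map_le_iff_le_comap.2 fun a ha => ?_)
  rw [Ideal.mem_comap, IsLocalization.algebraMap_mem_map_algebraMap_iff P.primeCompl]
  exact ⟨y, hyP, by rw [mul_comm]; exact (hmem a).1 ha⟩

/-- Powers of the maximal ideals of the localizations of `R` are integrally closed. -/
def HasIntegrallyClosedLocalPowers (R : Type*) [CommRing R] : Prop :=
  ∀ (P : Ideal R) [P.IsPrime] (n : ℕ) (y : Localization.AtPrime P),
    IsIntegralOverIdeal (maximalIdeal (Localization.AtPrime P) ^ n) y →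
      y ∈ maximalIdeal (Localization.AtPrime P) ^ n

theorem hasIntegrallyClosedLocalPowers_of_isRegular
    (hR : IsRegularLocalRing R ∨ IsRegularRing R) : HasIntegrallyClosedLocalPowers R := by
  intro P _ n y hy
  have : IsRegularLocalRing (Localization.AtPrime P) := by
    rcases hR with hR | hR
    · exact isRegularLocalRing_localization R P
    · infer_instance
  exact mem_maximalIdeal_pow_of_isIntegralOverIdeal hy

theorem mem_symbolicPower_iff {I : Ideal R} {n : ℕ} {x : R} :
    x ∈ symbolicPower I n ↔ ∀ P : PrimeSpectrum R, P.asIdeal ∈ associatedPrimes R (R ⧸ I) →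
      algebraMap R (Localization.AtPrime P.asIdeal) x ∈
        (I ^ n).map (algebraMap R (Localization.AtPrime P.asIdeal)) := by
  simp only [symbolicPower, contractAtAss, Submodule.mem_iInf, Ideal.mem_comap]

theorem mem_map_of_isIntegralOverIdeal_map [IsNoetherianRing R]
    (hR : HasIntegrallyClosedLocalPowers R) {I : Ideal R} (hI : I.IsRadical) {P : Ideal R}
    [P.IsPrime] (hP : P ∈ associatedPrimes R (R ⧸ I)) {n : ℕ} {y : Localization.AtPrime P}
    (hy : IsIntegralOverIdeal ((I ^ n).map (algebraMap R (Localization.AtPrime P))) y) :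
    y ∈ (I ^ n).map (algebraMap R (Localization.AtPrime P)) := by
  rw [Ideal.map_pow, map_eq_maximalIdeal_of_mem_associatedPrimes hI hP] at hy ⊢
  exact hR P n y hy

/-- Clear denominators by s ∉ P. One way, (sx)^q is integral over I^p, whose extension to R_P is
integrally closed. The other way, s x^q ∈ I^p gives (sx)^q ∈ I^p. -/
theorem algebraMap_mem_map_rationalPower_iff [IsNoetherianRing R]
    (hR : HasIntegrallyClosedLocalPowers R) {I : Ideal R} (hI : I.IsRadical) {P : Ideal R}
    [P.IsPrime] (hP : P ∈ associatedPrimes R (R ⧸ I)) {p q : ℕ} (hp : 0 < p) (hq : 0 < q) (x : R) :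
    algebraMap R (Localization.AtPrime P) x ∈
        (rationalPower I ((p : ℚ) / q)).map (algebraMap R (Localization.AtPrime P)) ↔
      algebraMap R (Localization.AtPrime P) (x ^ q) ∈
        (I ^ p).map (algebraMap R (Localization.AtPrime P)) := by
  rw [IsLocalization.algebraMap_mem_map_algebraMap_iff P.primeCompl]
  constructor
  · rintro ⟨s, hs, hsx⟩
    rw [mem_rationalPower_div_iff I hp hq] at hsx
    have h := mem_map_of_isIntegralOverIdeal_map hR hI hP
      (hsx.map (algebraMap R (Localization.AtPrime P)))
    have hu : IsUnit (algebraMap R (Localization.AtPrime P) (s ^ q)) :=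
      IsLocalization.map_units _ (⟨s ^ q, pow_mem hs q⟩ : P.primeCompl)
    rwa [mul_pow, map_mul, Ideal.unit_mul_mem_iff_mem _ hu] at h
  · rw [IsLocalization.algebraMap_mem_map_algebraMap_iff P.primeCompl]
    rintro ⟨s, hs, hsx⟩
    refine ⟨s, hs, (mem_rationalPower_div_iff I hp hq _).2 (isIntegralOverIdeal_of_mem ?_)⟩
    obtain ⟨k, rfl⟩ := Nat.exists_eq_add_of_le' hq
    have : (s * x) ^ (k + 1) = s ^ k * (s * x ^ (k + 1)) := by ring
    rw [this]
    exact Ideal.mul_mem_left _ _ hsx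

theorem mem_rationalSymbolicPower_div_iff [IsNoetherianRing R]
    (hR : HasIntegrallyClosedLocalPowers R) {I : Ideal R} (hI : I.IsRadical) {p q : ℕ}
    (hp : 0 < p) (hq : 0 < q) (x : R) :
    x ∈ rationalSymbolicPower I ((p : ℚ) / q) ↔ x ^ q ∈ symbolicPower I p := by
  rw [mem_symbolicPower_iff]
  simp only [rationalSymbolicPower, contractAtAss, Submodule.mem_iInf, Ideal.mem_comap]
  exact forall₂_congr fun P hP => algebraMap_mem_map_rationalPower_iff hR hI hP hp hq x

/-- An intersection of contractions of integrally closed ideals is integrally closed. -/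
theorem isIntegralOverIdeal_symbolicPower_iff [IsNoetherianRing R]
    (hR : HasIntegrallyClosedLocalPowers R) {I : Ideal R} (hI : I.IsRadical) {n : ℕ} {x : R} :
    IsIntegralOverIdeal (symbolicPower I n) x ↔ x ∈ symbolicPower I n := by
  refine ⟨fun h => mem_symbolicPower_iff.2 fun P hP => ?_, isIntegralOverIdeal_of_mem⟩
  refine mem_map_of_isIntegralOverIdeal_map hR hI hP
    ((h.map (algebraMap R (Localization.AtPrime P.asIdeal))).mono ?_)
  exact Ideal.map_le_iff_le_comap.2 fun y hy => mem_symbolicPower_iff.1 hy P hP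

end Symbolic

end RationalSymbolic

theorem mainTheorem1 {R : Type*} [CommRing R]
    (hR : IsRegularLocalRing R ∨ IsRegularRing R)
    (I : Ideal R) (hI : I.IsRadical) (p q : ℕ) (hp : 0 < p) (hq : 0 < q) :
    (RationalSymbolic.rationalSymbolicPower I ((p : ℚ) / (q : ℚ)) : Set R)
        = {x : R | x ^ q ∈ RationalSymbolic.rationalSymbolicPower I (p : ℚ)} ∧
    (RationalSymbolic.rationalSymbolicPower I ((p : ℚ) / (q : ℚ)) : Set R)
        = {x : R | x ^ q ∈ RationalSymbolic.idealIntegralClosure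
            (RationalSymbolic.symbolicPower I p)} ∧
    (RationalSymbolic.rationalSymbolicPower I ((p : ℚ) / (q : ℚ)) : Set R)
        = {x : R | x ^ q ∈ RationalSymbolic.symbolicPower I p} ∧
    RationalSymbolic.rationalSymbolicPower I ((p : ℚ) / (q : ℚ))
        = RationalSymbolic.rationalPower (RationalSymbolic.symbolicPower I p)
            (1 / (q : ℚ)) := by
  have : IsNoetherianRing R := by
    rcases hR with hR | hR <;> infer_instance
  have hcl := RationalSymbolic.hasIntegrallyClosedLocalPowers_of_isRegular hR
  have key := fun x => RationalSymbolic.mem_rationalSymbolicPower_div_iff hcl hI hp hq x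
  refine ⟨Set.ext fun x => ?_, Set.ext fun x => ?_, Set.ext fun x => key x, Ideal.ext fun x => ?_⟩
  -- Denominator one: for integer exponents the rational and ordinary symbolic powers agree.
  · have h1 := RationalSymbolic.mem_rationalSymbolicPower_div_iff hcl hI hp one_pos (x ^ q)
    rw [Nat.cast_one, div_one, pow_one] at h1
    exact (key x).trans h1.symm
  · exact (key x).trans (RationalSymbolic.isIntegralOverIdeal_symbolicPower_iff hcl hI).symm
  · have h1 := RationalSymbolic.mem_rationalPower_div_iff
      (RationalSymbolic.symbolicPower I p) one_pos hq x
    rw [Nat.cast_one, pow_one] at h1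
    exact (key x).trans
      ((RationalSymbolic.isIntegralOverIdeal_symbolicPower_iff hcl hI).symm.trans h1.symm)
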